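/- **Theorem.** Let $G$ be a group and let $(X,\pi)$ be a separable reflexive isometric Banach $G$-module, that is, $X$ is a separable reflexive real Banach space and $\pi$ is an action of $G$ on $X$ by surjective linear isometries. Let $F\leqslant G$ be a subgroup and let $$\mathsf{FC}_G(F)=\{g\in G : \{fgf^{-1} : f\in F\}\text{ is finite}\},$$ which is a subgroup of $G$. Assume that $X^{\mathsf{FC}_G(F)}=\{x\in X : \pi(g)x=x\text{ for all }g\in \mathsf{FC}_G(F)\}=\{0\}$. For a group $H$ acting on $X$ by linear isometries via $\pi$ and for $n\geqslant 0$, let $C^n(H,X)$ be the space of all maps $H^n\to X$ with the topology of pointwise convergence (with respect to the norm of $X$), let $\partial^{n+1}\colon C^n(H,X)\to C^{n+1}(H,X)$ be the coboundary operator $$(\partial^{n+1}\phi)(h_1,\ldots,h_{n+1})=-\pi(h_1)\phi(h_2,\ldots,h_{n+1})+(-1)^n\phi(h_1,\ldots,h_n)-\sum_{i=1}^n(-1)^i\phi(h_1,\ldots,h_{i-1},h_ih_{i+1},h_{i+2},\ldots,h_{n+1}),$$ and set $Z^n(H,X)=\ker\partial^{n+1}$, $B^0(H,X)=\{0\}$,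 $B^n(H,X)=\operatorname{im}\partial^n$ for $n\geqslant 1$, and $$\overline H^n(H,X)=Z^n(H,X)\big/\overline{B^n(H,X)},$$ where the closure is taken in $C^n(H,X)$. Then, for every $n\geqslant 0$, the restriction map $\overline H^n(G,X)\to\overline H^n(F,X)$, which sends the class of $\phi$ to the class of $\phi|_{F^n}$, is zero. In particular, if $\alpha$ is an action of $G$ on $X$ by affine isometries with linear part $\pi$, then $F$ has almost fixed points on $X$: for every finite set $E\subseteq F$ and every $\epsilon>0$ there is $x\in X$ with $\|x-\alpha(g)x\|<\epsilon$ for all $g\in E$. -/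

import Mathlib

open Topology

/-- A real normed space is reflexive if the canonical isometric embedding into its bidual is
onto. -/
def IsReflexiveSpace (X : Type*) [NormedAddCommGroup X] [NormedSpace ℝ X] : Prop :=
  Function.Surjective (NormedSpace.inclusionInDoubleDual ℝ X)

/-- `FC_G(F)`, the subgroup of all `g ∈ G` whose `F`-conjugacy class `{f g f⁻¹ | f ∈ F}` is
finite. -/
def fcSubgroup {G : Type*} [Group G] (F : Subgroup G) : Subgroup G where
  carrier := {g | {h : G | ∃ f ∈ F, h = f * g * f⁻¹}.Finite}
  mul_mem' := by
    intro a b ha hb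
    refine (ha.mul hb).subset ?_
    rintro _ ⟨f, hf, rfl⟩
    exact ⟨f * a * f⁻¹, ⟨f, hf, rfl⟩, f * b * f⁻¹, ⟨f, hf, rfl⟩, by simp [mul_assoc]⟩
  one_mem' := by
    refine (Set.finite_singleton (1 : G)).subset ?_
    rintro _ ⟨f, hf, rfl⟩
    simp
  inv_mem' := by
    intro a ha
    refine (Set.Finite.inv ha).subset ?_
    rintro _ ⟨f, hf, rfl⟩
    exact ⟨f, hf, by simp [mul_assoc]⟩

namespace IsometricModule

variable {G X : Type*} [Group G] [NormedAddCommGroup X] [NormedSpace ℝ X]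

/-- `X^H`, the vectors fixed by every element of the subgroup `H`. -/
def invariants (π : G →* (X ≃ₗᵢ[ℝ] X)) (H : Subgroup G) : Submodule ℝ X where
  carrier := {x | ∀ h ∈ H, π h x = x}
  add_mem' := by
    intro x y hx hy h hh
    rw [map_add, hx h hh, hy h hh]
  zero_mem' := by
    intro h _
    exact map_zero _
  smul_mem' := by
    intro c x hx h hh
    rw [map_smul, hx h hh]

/-- The space `C^n(G, X)` of all maps `G^n → X`, with the (product) topology of pointwise
convergence. -/
abbrev Cochain (G X : Type*) (n : ℕ) : Type _ := (Fin n → G) → X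

/-- The coboundary operator `∂^{n+1} : C^n(G, X) → C^{n+1}(G, X)`,
`(∂φ)(g₁, …, gₙ₊₁) = -π(g₁) φ(g₂, …, gₙ₊₁) + (-1)^n φ(g₁, …, gₙ)
  - ∑_{i=1}^n (-1)^i φ(g₁, …, gᵢgᵢ₊₁, …, gₙ₊₁)`;
the summation index below is `i - 1`. -/
def coboundary (π : G →* (X ≃ₗᵢ[ℝ] X)) (n : ℕ) : Cochain G X n →ₗ[ℝ] Cochain G X (n + 1) where
  toFun φ g := -π (g 0) (φ (Fin.tail g)) + (-1 : ℝ) ^ n • φ (Fin.init g)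
    - ∑ i : Fin n, (-1 : ℝ) ^ ((i : ℕ) + 1) • φ (Fin.contractNth i.castSucc (· * ·) g)
  map_add' φ ψ := by
    funext g
    simp only [Pi.add_apply, map_add, smul_add, Finset.sum_add_distrib]
    abel
  map_smul' c φ := by
    funext g
    simp only [Pi.smul_apply, map_smul, RingHom.id_apply, smul_sub, smul_add, smul_neg,
      Finset.smul_sum]
    simp only [smul_comm c]

/-- The space `Z^n(G, X)` of cocycles. -/
def cocycles (π : G →* (X ≃ₗᵢ[ℝ] X)) (n : ℕ) : Submodule ℝ (Cochain G X n) :=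
  LinearMap.ker (coboundary π n)

/-- The space `B^n(G, X)` of coboundaries; `B^0(G, X) = 0`. -/
def coboundaries (π : G →* (X ≃ₗᵢ[ℝ] X)) : (n : ℕ) → Submodule ℝ (Cochain G X n)
  | 0 => ⊥
  | n + 1 => LinearMap.range (coboundary π n)

/-- The closure of `B^n(G, X)` in `C^n(G, X)`, viewed as a subspace of `Z^n(G, X)`. -/
def closedCoboundaries (π : G →* (X ≃ₗᵢ[ℝ] X)) (n : ℕ) : Submodule ℝ (cocycles π n) :=
  (coboundaries π n).topologicalClosure.comap (cocycles π n).subtype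

/-- The reduced cohomology: cocycles modulo the closure of the coboundaries. -/
abbrev ReducedCohomology (π : G →* (X ≃ₗᵢ[ℝ] X)) (n : ℕ) : Type _ :=
  cocycles π n ⧸ closedCoboundaries π n

/-- The module `X` with the action restricted to the subgroup `F`. -/
abbrev restrict (π : G →* (X ≃ₗᵢ[ℝ] X)) (F : Subgroup G) : F →* (X ≃ₗᵢ[ℝ] X) :=
  π.comp F.subtype

/-- Restriction of cochains from `G` to `F`. -/
def resCochain (X : Type*) [NormedAddCommGroup X] [NormedSpace ℝ X] (F : Subgroup G) (n : ℕ) :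
    Cochain G X n →ₗ[ℝ] Cochain F X n where
  toFun φ f := φ (fun i => (f i : G))
  map_add' _ _ := rfl
  map_smul' _ _ := rfl

theorem coboundary_resCochain (π : G →* (X ≃ₗᵢ[ℝ] X)) (F : Subgroup G) (n : ℕ)
    (φ : Cochain G X n) :
    coboundary (restrict π F) n (resCochain X F n φ)
      = resCochain X F (n + 1) (coboundary π n φ) := by
  have key : ∀ (f : Fin (n + 1) → F) (i : Fin n),
      (fun j => ((Fin.contractNth i.castSucc (· * ·) f j : F) : G))
        = Fin.contractNth i.castSucc (· * ·) (fun j => (f j : G)) := by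
    intro f i
    funext j
    simp only [Fin.contractNth]
    split_ifs <;> rfl
  funext f
  simp only [coboundary, resCochain, LinearMap.coe_mk, AddHom.coe_mk, key]
  rfl

theorem resCochain_mem_cocycles (π : G →* (X ≃ₗᵢ[ℝ] X)) (F : Subgroup G) (n : ℕ) :
    ∀ φ ∈ cocycles π n, resCochain X F n φ ∈ cocycles (restrict π F) n := by
  intro φ hφ
  have h : coboundary π n φ = 0 := hφ
  change coboundary (restrict π F) n (resCochain X F n φ) = 0
  rw [coboundary_resCochain, h, map_zero]

theorem resCochain_mem_coboundaries (π : G →* (X ≃ₗᵢ[ℝ] X)) (F : Subgroup G) (n : ℕ) :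
    ∀ φ ∈ coboundaries π n, resCochain X F n φ ∈ coboundaries (restrict π F) n := by
  intro φ hφ
  cases n with
  | zero =>
    have h : φ = 0 := hφ
    rw [h, map_zero]
    exact Submodule.zero_mem _
  | succ n =>
    obtain ⟨ψ, rfl⟩ := hφ
    exact ⟨resCochain X F n ψ, coboundary_resCochain π F n ψ⟩

theorem resCochain_mem_closure (π : G →* (X ≃ₗᵢ[ℝ] X)) (F : Subgroup G) (n : ℕ) :
    ∀ φ ∈ (coboundaries π n).topologicalClosure,
      resCochain X F n φ ∈ (coboundaries (restrict π F) n).topologicalClosure := by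
  intro φ hφ
  have hc : Continuous (resCochain X F n) :=
    continuous_pi fun f => continuous_apply (fun i => (f i : G))
  exact map_mem_closure hc hφ (resCochain_mem_coboundaries π F n)

/-- Restriction of cocycles from `G` to `F`. -/
def resCocycles (π : G →* (X ≃ₗᵢ[ℝ] X)) (F : Subgroup G) (n : ℕ) :
    cocycles π n →ₗ[ℝ] cocycles (restrict π F) n :=
  (resCochain X F n).restrict (resCochain_mem_cocycles π F n)

/-- The restriction map from the reduced cohomology of `G` to that of `F`, sending the class of
a cocycle `φ` to the class of `φ|_F`. -/
def resReducedCohomology (π : G →* (X ≃ₗᵢ[ℝ] X)) (F : Subgroup G) (n : ℕ) :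
    ReducedCohomology π n →ₗ[ℝ] ReducedCohomology (restrict π F) n :=
  (closedCoboundaries π n).mapQ (closedCoboundaries (restrict π F) n) (resCocycles π F n)
    (fun φ hφ => resCochain_mem_closure π F n φ.1 hφ)

/-- The affine isometric action `α` has linear part `π`. -/
def HasLinearPart (α : G →* (X ≃ᵃⁱ[ℝ] X)) (π : G →* (X ≃ₗᵢ[ℝ] X)) : Prop :=
  ∀ g, (α g).linearIsometryEquiv = π g

/-- An affine isometric action has almost fixed points if, for every finite set `E` of group
elements and `ε > 0`, some point is moved by less than `ε` by all elements of `E`. -/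
def HasAlmostFixedPoints (α : G →* (X ≃ᵃⁱ[ℝ] X)) : Prop :=
  ∀ (E : Finset G) (ε : ℝ), 0 < ε → ∃ x : X, ∀ g ∈ E, ‖x - α g x‖ < ε

end IsometricModule

/-! ### Weak limits, dentability and fixed points in reflexive spaces -/

section Reflexive

open Filter

variable {X : Type*} [NormedAddCommGroup X] [NormedSpace ℝ X]

/-! Let `E` be a finite nonempty set invariant under conjugation by `F`. Conjugation by a group
element acts trivially on cohomology; summing the explicit homotopies over `E` gives an
`F`-equivariant one (`sum_sub_mem_coboundaries`). So the average over `E` commutes with `F` and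
fixes every class restricted from `G`. In positive degree, the contractions with these two
properties form a convex semigroup `P`. If some `p ∈ P` is small on the finitely many values of
`φ|_F` that a neighbourhood tests, the coboundary `φ|_F - p φ|_F` is close to `φ|_F` there, so the
restricted class vanishes.

Such a `p` exists because `0` lies in the closure of each orbit `P x`. That closure is bounded,
convex and invariant under all averages. Each average fixes a point of it by the mean ergodic
argument, and a point fixed by an average over `E` is fixed by each element of `E`
(`apply_eq_of_sum_apply_sub_eq_zero`); dentability of the orbit plays the role of strict convexity
here. The sets `E` are directed and exhaust `FC_G(F)`, so a weak limit of these points is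
`FC_G(F)`-invariant, hence zero. -/

/-- In a reflexive space, a bounded family has a weak limit along any ultrafilter. -/
theorem IsReflexiveSpace.exists_weak_limit (hX : IsReflexiveSpace X) {ι : Type*}
    (U : Ultrafilter ι) {x : ι → X} {M : ℝ} (hM : ∀ i, ‖x i‖ ≤ M) :
    ∃ z : X, ∀ l : StrongDual ℝ X, Tendsto (fun i => l (x i)) U (𝓝 (l z)) := by
  have hc := WeakDual.isCompact_closedBall (0 : StrongDual ℝ (StrongDual ℝ X)) M
  let e : ι → WeakDual ℝ (StrongDual ℝ X) := fun i =>
    StrongDual.toWeakDual (NormedSpace.inclusionInDoubleDual ℝ X (x i))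
  obtain ⟨w, -, hw⟩ := hc.ultrafilter_le_nhds (U.map e) (by
    rw [le_principal_iff, Ultrafilter.mem_coe, Ultrafilter.mem_map]
    refine Eventually.of_forall fun i => ?_
    simp only [Set.mem_preimage, Metric.mem_closedBall, dist_zero_right]
    exact (NormedSpace.double_dual_bound ℝ X (x i)).trans (hM i))
  obtain ⟨z, hz⟩ := hX (WeakDual.toStrongDual w)
  refine ⟨z, fun l => ?_⟩
  have h1 : Tendsto (fun v : WeakDual ℝ (StrongDual ℝ X) => v l) (𝓝 w) (𝓝 (w l)) :=
    (WeakDual.eval_continuous l).tendsto w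
  have h2 : w l = l z := by
    rw [← NormedSpace.dual_def ℝ X z l, hz]
    rfl
  rw [← h2]
  exact h1.comp hw

/-- A closed convex set contains the weak limits of its elements. -/
theorem IsClosed.mem_of_weak_limit {K : Set X} (hK : IsClosed K) (hc : Convex ℝ K) {ι : Type*}
    {U : Filter ι} [U.NeBot] {x : ι → X} (hx : ∀ᶠ i in U, x i ∈ K) {z : X}
    (hz : ∀ l : StrongDual ℝ X, Tendsto (fun i => l (x i)) U (𝓝 (l z))) : z ∈ K := by
  by_contra h
  obtain ⟨f, u, hf, hu⟩ := geometric_hahn_banach_closed_point hc hK h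
  exact absurd (le_of_tendsto (hz f) (hx.mono fun i hi => (hf _ hi).le)) (not_le.2 hu)

/-- A continuous linear functional attains its supremum over a bounded set on the closed convex
hull of that set. -/
theorem IsReflexiveSpace.exists_forall_le (hX : IsReflexiveSpace X) {D : Set X}
    (hD : D.Nonempty) {M : ℝ} (hM : ∀ x ∈ D, ‖x‖ ≤ M) (l : StrongDual ℝ X) :
    ∃ z ∈ closedConvexHull ℝ D, ∀ y ∈ D, l y ≤ l z := by
  have hb : BddAbove (l '' D) := by
    refine ⟨‖l‖ * M, ?_⟩
    rintro _ ⟨x, hx, rfl⟩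
    exact (le_abs_self _).trans ((l.le_opNorm x).trans (by gcongr; exact hM x hx))
  obtain ⟨u, -, hu, huD⟩ := exists_seq_tendsto_sSup (hD.image l) hb
  choose x hxD hx using huD
  obtain ⟨z, hz⟩ := hX.exists_weak_limit (hyperfilter ℕ) (fun n => hM _ (hxD n))
  refine ⟨z, isClosed_closedConvexHull.mem_of_weak_limit convex_closedConvexHull
    (Eventually.of_forall fun n => subset_closedConvexHull (hxD n)) hz, fun y hy => ?_⟩
  have h1 : Tendsto (fun n => l (x n)) (hyperfilter ℕ) (𝓝 (sSup (l '' D))) := by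
    simp only [hx]
    exact hu.mono_left Nat.hyperfilter_le_atTop
  rw [tendsto_nhds_unique (hz l) h1]
  exact le_csSup hb ⟨y, hy, rfl⟩

theorem le_of_mem_closedConvexHull {D : Set X} {l : StrongDual ℝ X} {a : ℝ}
    (h : ∀ y ∈ D, l y ≤ a) {x : X} (hx : x ∈ closedConvexHull ℝ D) : l x ≤ a := by
  have : closedConvexHull ℝ D ⊆ {y | l y ≤ a} :=
    closedConvexHull_min h (convex_halfSpace_le l.toLinearMap.isLinear a)
      (isClosed_le l.continuous continuous_const)
  exact this hx

/-- Bounded sets in separable reflexive spaces are dentable. -/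
theorem IsReflexiveSpace.exists_slice [TopologicalSpace.SeparableSpace X]
    (hX : IsReflexiveSpace X) {D : Set X} (hD : D.Nonempty) {M : ℝ} (hM : ∀ x ∈ D, ‖x‖ ≤ M)
    {ε : ℝ} (hε : 0 < ε) :
    ∃ (l : StrongDual ℝ X) (a : ℝ), (∃ x ∈ D, a < l x) ∧
      ∀ x ∈ D, ∀ y ∈ D, a < l x → a < l y → ‖x - y‖ ≤ ε := by
  have : Nonempty X := ⟨0⟩
  let d := TopologicalSpace.denseSeq X
  let K := closedConvexHull ℝ D
  -- Baire category: these sets are closed by weak compactness and cover the dual, since each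
  -- functional attains its supremum within `ε / 4` of some `d j`. One of them therefore contains a
  -- ball.
  let A : ℕ → Set (StrongDual ℝ X) := fun j =>
    {l | ∃ x ∈ K ∩ Metric.closedBall (d j) (ε / 4), ∀ y ∈ D, l y ≤ l x}
  have hA : ∀ j, IsClosed (A j) := by
    intro j
    refine IsSeqClosed.isClosed fun l l' hl hl' => ?_
    choose x hx hxl using hl
    have hxb : ∀ n, ‖x n‖ ≤ ‖d j‖ + ε / 4 := fun n => by
      have h := (hx n).2
      rw [mem_closedBall_iff_norm] at h
      linarith [norm_le_norm_add_norm_sub (d j) (x n), norm_sub_rev (d j) (x n)]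
    obtain ⟨z, hz⟩ := hX.exists_weak_limit (hyperfilter ℕ) hxb
    refine ⟨z, (isClosed_closedConvexHull.inter Metric.isClosed_closedBall).mem_of_weak_limit
      (convex_closedConvexHull.inter (convex_closedBall _ _)) (Eventually.of_forall hx) hz,
      fun y hy => ?_⟩
    have hU := hl'.mono_left Nat.hyperfilter_le_atTop
    have h1 : Tendsto (fun n => l n (x n)) (hyperfilter ℕ) (𝓝 (l' z)) := by
      have h2 : Tendsto (fun n => (l n - l') (x n)) (hyperfilter ℕ) (𝓝 0) := by
        have h3 : Tendsto (fun n => ‖l n - l'‖ * (‖d j‖ + ε / 4)) (hyperfilter ℕ) (𝓝 0) := by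
          simpa using (tendsto_iff_norm_sub_tendsto_zero.1 hU).mul_const (‖d j‖ + ε / 4)
        exact squeeze_zero_norm (fun n => ((l n - l').le_opNorm (x n)).trans
          (mul_le_mul_of_nonneg_left (hxb n) (norm_nonneg _))) h3
      simpa using h2.add (hz l')
    have h4 : Tendsto (fun n => l n y) (hyperfilter ℕ) (𝓝 (l' y)) :=
      ((ContinuousLinearMap.apply ℝ ℝ y).continuous.tendsto l').comp hU
    exact le_of_tendsto_of_tendsto' h4 h1 fun n => hxl n y hy
  have hU : ⋃ j, A j = Set.univ := by
    refine Set.eq_univ_of_forall fun l => ?_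
    obtain ⟨z, hz, hl⟩ := hX.exists_forall_le hD hM l
    obtain ⟨j, hj⟩ := (TopologicalSpace.denseRange_denseSeq X).exists_dist_lt z
      (by positivity : 0 < ε / 4)
    exact Set.mem_iUnion.2 ⟨j, z, ⟨hz, Metric.mem_closedBall.2 hj.le⟩, hl⟩
  obtain ⟨j, l, hl⟩ := nonempty_interior_of_iUnion_of_closed hA hU
  obtain ⟨r, hr, hball⟩ := Metric.isOpen_iff.1 isOpen_interior l hl
  obtain ⟨x₀, hx₀, hlx₀⟩ := interior_subset hl
  refine ⟨l, l x₀ - r / 2 * (ε / 4), ?_, ?_⟩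
  · by_contra! h
    have := le_of_mem_closedConvexHull h hx₀.1
    have : 0 < r / 2 * (ε / 4) := by positivity
    linarith
  · have key : ∀ x ∈ D, l x₀ - r / 2 * (ε / 4) < l x → ‖x - d j‖ ≤ ε / 4 + ε / 4 := by
      intro x hx hlx
      by_contra! hd
      have hne : x - d j ≠ 0 := by
        intro h
        rw [h, norm_zero] at hd
        linarith
      obtain ⟨h, hh, hhx⟩ := exists_dual_vector ℝ (x - d j) (norm_ne_zero_iff.2 hne)
      -- Tilting `l` towards `x` keeps it in `A j`, so its maximiser `b` stays near `d j`. As `h`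
      -- separates `x` from `b` by more than `ε / 4`, maximality at `b` pushes `l x` below the level
      -- of the slice.
      have hmem : l + (r / 2) • h ∈ A j := by
        refine interior_subset (hball ?_)
        rw [mem_ball_iff_norm, add_sub_cancel_left, norm_smul, hh, mul_one, Real.norm_eq_abs,
          abs_of_pos (half_pos hr)]
        exact half_lt_self hr
      obtain ⟨b, hb, hlb⟩ := hmem
      have h1 := hlb x hx
      simp only [add_apply, smul_apply, smul_eq_mul] at h1
      have h2 : l b ≤ l x₀ := le_of_mem_closedConvexHull hlx₀ hb.1
      have h3 : h (b - d j) ≤ ε / 4 := by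
        refine (le_abs_self _).trans ((h.le_opNorm _).trans ?_)
        rw [hh, one_mul]
        exact mem_closedBall_iff_norm.1 hb.2
      rw [map_sub] at h3
      rw [map_sub] at hhx
      simp only [RCLike.ofReal_real_eq_id, id] at hhx
      have h4 : ε / 4 < h x - h b := by linarith
      have h5 := mul_lt_mul_of_pos_left h4 (half_pos hr)
      linarith
    intro x hx y hy hlx hly
    have h1 := key x hx hlx
    have h2 := key y hy hly
    have h3 := norm_sub_le_norm_sub_add_norm_sub x (d j) y
    rw [norm_sub_rev (d j) y] at h3
    linarith

/-- A linear contraction of a reflexive space has a fixed point in every nonempty bounded closed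
convex invariant set. -/
theorem IsReflexiveSpace.exists_fixed_mem (hX : IsReflexiveSpace X) {K : Set X}
    (hK : IsClosed K) (hc : Convex ℝ K) (hne : K.Nonempty) {M : ℝ} (hM : ∀ x ∈ K, ‖x‖ ≤ M)
    (p : X →L[ℝ] X) (hp : ∀ x ∈ K, p x ∈ K) : ∃ y ∈ K, p y = y := by
  obtain ⟨x, hx⟩ := hne
  have hit : ∀ k, p^[k] x ∈ K := fun k => by
    induction k with
    | zero => exact hx
    | succ k ih => rw [Function.iterate_succ_apply']; exact hp _ ih
  -- The shift avoids the empty average, which is `0` and need not lie in `K`.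
  let b : ℕ → X := fun n => birkhoffAverage ℝ p id (n + 1) x
  have hb : ∀ n, b n ∈ K := fun n => by
    simp only [b, birkhoffAverage, birkhoffSum, Finset.smul_sum]
    refine hc.sum_mem (fun _ _ => by positivity) ?_ fun k _ => hit k
    simp
    field_simp
  obtain ⟨y, hy⟩ := hX.exists_weak_limit (hyperfilter ℕ) fun n => hM _ (hb n)
  refine ⟨y, hK.mem_of_weak_limit hc (Eventually.of_forall hb) hy, ?_⟩
  have hpb : Tendsto (fun n => p (b n) - b n) atTop (𝓝 0) := by
    have h1 : Bornology.IsBounded (Set.range fun n => id (p^[n] x)) :=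
      (isBounded_iff_forall_norm_le.2 ⟨M, hM⟩).subset (Set.range_subset_iff.2 hit)
    have h2 := (tendsto_birkhoffAverage_apply_sub_birkhoffAverage ℝ h1).comp
      (tendsto_add_atTop_nat 1)
    refine h2.congr fun n => ?_
    have h3 : p (b n) = birkhoffAverage ℝ p id (n + 1) (p x) := by
      simp only [b, birkhoffAverage, birkhoffSum, map_smul, map_sum, id,
        ← Function.iterate_succ_apply, Function.iterate_succ_apply']
    simp only [Function.comp_apply, h3, b]
  refine eq_of_sub_eq_zero (SeparatingDual.eq_zero_of_forall_dual_eq_zero (R := ℝ) fun l => ?_)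
  have h1 : Tendsto (fun n => l (p (b n) - b n)) (hyperfilter ℕ) (𝓝 (l (p y - y))) := by
    simp only [map_sub]
    exact (hy (l.comp p)).sub (hy l)
  have h2 : Tendsto (fun n => l (p (b n) - b n)) (hyperfilter ℕ) (𝓝 (l 0)) :=
    ((l.continuous.tendsto 0).comp hpb).mono_left Nat.hyperfilter_le_atTop
  rw [tendsto_nhds_unique h1 h2, map_zero]

end Reflexive

/-! ### The chain homotopy for conjugation -/

namespace IsometricModule

section Homotopy

variable {G X : Type*} [Group G] [NormedAddCommGroup X]

/-- The prism operator: the alternating sum over `j` of the values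
`φ(k₁, …, kⱼ, (k₁⋯kⱼ)⁻¹ c k₁⋯kⱼ, kⱼ₊₁, …, kₙ)`. -/
def prism : (n : ℕ) → G → Cochain G X (n + 1) → Cochain G X n
  | 0, c, φ => fun l => φ (Fin.cons c l)
  | n + 1, c, φ => fun l => φ (Fin.cons c l)
      - prism n ((l 0)⁻¹ * c * l 0) (fun m => φ (Fin.cons (l 0) m)) (Fin.tail l)

theorem prism_cons (n : ℕ) (c k : G) (φ : Cochain G X (n + 2)) (l : Fin n → G) :
    prism (n + 1) c φ (Fin.cons k l) = φ (Fin.cons c (Fin.cons k l))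
      - prism n (k⁻¹ * c * k) (fun m => φ (Fin.cons k m)) l := by
  simp [prism]

theorem prism_map (f : X →+ X) (n : ℕ)
    (c : G) (φ : Cochain G X (n + 1)) (l : Fin n → G) :
    prism n c (fun m => f (φ m)) l = f (prism n c φ l) := by
  induction n generalizing c with
  | zero => rfl
  | succ n ih => simp only [prism, ih _ (fun m => φ (Fin.cons (l 0) m)), map_sub]

theorem prism_add (n : ℕ) (c : G) (φ ψ : Cochain G X (n + 1)) (l : Fin n → G) :
    prism n c (fun m => φ m + ψ m) l = prism n c φ l + prism n c ψ l := by
  induction n generalizing c with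
  | zero => rfl
  | succ n ih =>
    simp only [prism, ih _ (fun m => φ (Fin.cons (l 0) m)) (fun m => ψ (Fin.cons (l 0) m))]
    abel

theorem prism_neg (n : ℕ) (c : G) (φ : Cochain G X (n + 1)) (l : Fin n → G) :
    prism n c (fun m => -φ m) l = -prism n c φ l :=
  prism_map (-AddMonoidHom.id X) n c φ l

variable [NormedSpace ℝ X]

/-- The terms of the standard coboundary operator that do not involve the action. -/
def innerCoboundary (n : ℕ) (φ : Cochain G X n) : Cochain G X (n + 1) := fun g =>
  (-1 : ℝ) ^ (n + 1) • φ (Fin.init g)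
    + ∑ i : Fin n, (-1 : ℝ) ^ ((i : ℕ) + 1) • φ (Fin.contractNth i.castSucc (· * ·) g)

theorem coboundary_apply (π : G →* (X ≃ₗᵢ[ℝ] X)) (n : ℕ) (φ : Cochain G X n)
    (g : Fin (n + 1) → G) :
    coboundary π n φ g = -π (g 0) (φ (Fin.tail g)) - innerCoboundary n φ g := by
  simp only [coboundary, innerCoboundary, LinearMap.coe_mk, AddHom.coe_mk, pow_succ, mul_neg,
    mul_one, neg_smul]
  abel

theorem innerCoboundary_zero (φ : Cochain G X 0) (g : Fin 1 → G) :
    innerCoboundary 0 φ g = -φ (Fin.tail g) := by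
  simp [innerCoboundary, Subsingleton.elim (Fin.init g) (Fin.tail g)]

theorem contractNth_zero_cons_cons {n : ℕ} (a b : G) (l : Fin n → G) :
    Fin.contractNth 0 (· * ·) (Fin.cons a (Fin.cons b l) : Fin (n + 2) → G)
      = Fin.cons (a * b) l := by
  funext j
  cases j using Fin.cases with
  | zero => simp [Fin.contractNth]
  | succ j => simp [Fin.contractNth]

theorem contractNth_succ_cons {n : ℕ} (i : Fin (n + 1)) (a : G) (m : Fin (n + 1) → G) :
    Fin.contractNth i.succ (· * ·) (Fin.cons a m : Fin (n + 2) → G)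
      = Fin.cons a (Fin.contractNth i (· * ·) m) := by
  funext j
  cases j using Fin.cases with
  | zero => simp [Fin.contractNth]
  | succ j => simp [Fin.contractNth]

/-- Freezing the first argument leaves the same operator one degree lower; this recursion drives the
induction for the homotopy formula. -/
theorem innerCoboundary_succ (n : ℕ) (φ : Cochain G X (n + 1)) (a b : G) (l : Fin n → G) :
    innerCoboundary (n + 1) φ (Fin.cons a (Fin.cons b l))
      = -φ (Fin.cons (a * b) l)
        - innerCoboundary n (fun m => φ (Fin.cons a m)) (Fin.cons b l) := by
  have hinit : (Fin.init (Fin.cons a (Fin.cons b l) : Fin (n + 2) → G) : Fin (n + 1) → G)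
      = Fin.cons a (Fin.init (Fin.cons b l : Fin (n + 1) → G)) := by
    funext j
    cases j using Fin.cases <;> rfl
  simp only [innerCoboundary, Fin.sum_univ_succ, Fin.castSucc_zero, contractNth_zero_cons_cons,
    ← Fin.succ_castSucc, contractNth_succ_cons, hinit, Fin.val_zero, Fin.val_succ,
    pow_succ, mul_neg, mul_one, neg_smul, Finset.sum_neg_distrib]
  simp
  abel

/-- Faces multiplying the inserted conjugate into its neighbours cancel in pairs, because `c * k = k
* (k⁻¹ * c * k)`. Faces away from it cancel against those of `prism n c φ`, and the face that drops
it from the last place remains. -/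
theorem prism_innerCoboundary (n : ℕ) (c : G) (φ : Cochain G X (n + 1)) (l : Fin (n + 1) → G) :
    prism (n + 1) c (innerCoboundary (n + 1) φ) l + innerCoboundary n (prism n c φ) l
      = -φ l := by
  induction n generalizing c with
  | zero =>
    obtain ⟨k, l, rfl⟩ : ∃ k l', l = Fin.cons k l' := ⟨_, _, (Fin.cons_self_tail l).symm⟩
    simp only [prism, innerCoboundary_succ, innerCoboundary_zero, Fin.tail_cons]
    simp [mul_assoc]
    abel
  | succ n ih =>
    obtain ⟨k, l, rfl⟩ : ∃ k l', l = Fin.cons k l' := ⟨_, _, (Fin.cons_self_tail l).symm⟩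
    obtain ⟨b, l, rfl⟩ : ∃ k l', l = Fin.cons k l' := ⟨_, _, (Fin.cons_self_tail l).symm⟩
    have hm : (fun m : Fin (n + 2) → G => innerCoboundary (n + 2) φ (Fin.cons k m))
        = fun m => -φ (Fin.cons (k * m 0) (Fin.tail m))
          + -innerCoboundary (n + 1) (fun m => φ (Fin.cons k m)) m := by
      funext m
      obtain ⟨a, m, rfl⟩ : ∃ a m', m = Fin.cons a m' := ⟨_, _, (Fin.cons_self_tail m).symm⟩
      rw [innerCoboundary_succ, Fin.cons_zero, Fin.tail_cons, sub_eq_add_neg]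
    have h1 := ih (k⁻¹ * c * k) (fun m => φ (Fin.cons k m)) (Fin.cons b l)
    have hin : innerCoboundary n (fun m => prism (n + 1) c φ (Fin.cons k m)) (Fin.cons b l)
        = innerCoboundary n (fun m => φ (Fin.cons c (Fin.cons k m))) (Fin.cons b l)
          - innerCoboundary n (prism n (k⁻¹ * c * k) (fun m => φ (Fin.cons k m)))
            (Fin.cons b l) := by
      simp only [prism_cons, innerCoboundary, smul_sub, Finset.sum_sub_distrib]
      abel
    rw [prism_cons, hm, prism_add (n + 1), prism_neg (n + 1), prism_neg (n + 1),
      innerCoboundary_succ,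
      innerCoboundary_succ n (prism (n + 1) c φ), hin, innerCoboundary_succ,
      eq_sub_of_add_eq h1]
    simp only [prism_cons, Fin.cons_zero, Fin.tail_cons, mul_inv_rev, mul_assoc, mul_inv_cancel_left]
    abel

/-- Summing the prism operator over a finite set of elements that is invariant under conjugation
by a subgroup gives a chain homotopy over this subgroup. -/
theorem sum_sub_mem_coboundaries (π : G →* (X ≃ₗᵢ[ℝ] X)) (F : Subgroup G) {n : ℕ}
    {φ : Cochain G X (n + 1)} (hφ : φ ∈ cocycles π (n + 1)) {E : Finset G}
    (hE : ∀ f ∈ F, ∀ c ∈ E, f * c * f⁻¹ ∈ E) :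
    (fun k : Fin (n + 1) → F => ∑ c ∈ E, (π c (resCochain X F _ φ k) - resCochain X F _ φ k))
      ∈ coboundaries (restrict π F) (n + 1) := by
  have hD : innerCoboundary (n + 1) φ = fun m => -π (m 0) (φ (Fin.tail m)) := by
    funext m
    have h : coboundary π (n + 1) φ = 0 := hφ
    have h1 := congrFun h m
    rw [coboundary_apply, Pi.zero_apply, sub_eq_zero] at h1
    exact h1.symm
  -- The face with the action contributes `π c` when `c` stands first, and otherwise a prism term
  -- for `k⁻¹ * c * k`. For a single `c` this conjugate prevents the left side from being a
  -- coboundary up to sign.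
  have hc : ∀ (c k : G) (l : Fin n → G),
      innerCoboundary n (prism n c φ) (Fin.cons k l) + π k (prism n (k⁻¹ * c * k) φ l)
        = π c (φ (Fin.cons k l)) - φ (Fin.cons k l) := by
    intro c k l
    have h := prism_innerCoboundary n c φ (Fin.cons k l)
    rw [hD, prism_neg, prism_cons] at h
    simp only [Fin.cons_zero, Fin.tail_cons] at h
    have h1 : prism n (k⁻¹ * c * k) (fun m => π k (φ m)) l = π k (prism n (k⁻¹ * c * k) φ l) :=
      prism_map (π k : X →+ X) n (k⁻¹ * c * k) φ l
    rw [h1] at h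
    rw [sub_eq_add_neg (π c _), ← h]
    abel
  let Ψ : Cochain G X n := fun l => ∑ c ∈ E, prism n c φ l
  refine ⟨-resCochain X F n Ψ, ?_⟩
  rw [map_neg, coboundary_resCochain]
  funext k
  let g : Fin (n + 1) → G := fun i => k i
  change -coboundary π n Ψ g = ∑ c ∈ E, (π c (φ g) - φ g)
  have hinner : innerCoboundary n Ψ g = ∑ c ∈ E, innerCoboundary n (prism n c φ) g := by
    simp only [innerCoboundary, Ψ, Finset.smul_sum, Finset.sum_add_distrib]
    rw [Finset.sum_comm]
  -- Conjugation by `g 0 ∈ F` permutes `E`, which absorbs the twist.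
  have hconj : Ψ (Fin.tail g) = ∑ c ∈ E, prism n ((g 0)⁻¹ * c * g 0) φ (Fin.tail g) := by
    refine Finset.sum_nbij' (fun c => g 0 * c * (g 0)⁻¹) (fun c => (g 0)⁻¹ * c * g 0)
      (fun c hc => hE _ (k 0).2 c hc) (fun c hc => ?_) ?_ ?_ ?_
    · simpa using hE _ (F.inv_mem (k 0).2) c hc
    all_goals intro c _; simp [mul_assoc]
  rw [coboundary_apply, hinner, hconj, map_sum, neg_sub_left, neg_neg, ← Finset.sum_add_distrib]
  refine Finset.sum_congr rfl fun c _ => ?_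
  have h := hc c (g 0) (Fin.tail g)
  rw [Fin.cons_self_tail] at h
  exact h

end Homotopy

end IsometricModule

/-! ### Averages over stable sets and almost annihilating contractions -/

namespace IsometricModule

section AlmostInvariant

open Filter

variable {G X : Type*} [Group G] [NormedAddCommGroup X] [NormedSpace ℝ X]

theorem map_mul_apply (π : G →* (X ≃ₗᵢ[ℝ] X)) (g h : G) (x : X) :
    π (g * h) x = π g (π h x) := by
  rw [map_mul]
  rfl

/-- If a vector is the barycentre of finitely many of its translates, then it is equal to each of
these translates. -/
theorem apply_eq_of_sum_apply_sub_eq_zero [TopologicalSpace.SeparableSpace X]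
    (hX : IsReflexiveSpace X) (π : G →* (X ≃ₗᵢ[ℝ] X)) {E : Finset G} {y : X}
    (h : ∑ c ∈ E, (π c y - y) = 0) : ∀ c ∈ E, π c y = y := by
  classical
  let B := E.filter fun c => π c y - y ≠ 0
  have hB : ∑ c ∈ B, (π c y - y) = 0 := by rw [Finset.sum_filter_ne_zero, h]
  rcases B.eq_empty_or_nonempty with hne | hne
  · intro c hc
    by_contra hcy
    have : c ∈ B := Finset.mem_filter.2 ⟨hc, sub_ne_zero.2 hcy⟩
    simp [hne] at this
  · exfalso
    obtain ⟨b, hb, hmin⟩ := B.exists_min_image (fun c => ‖π c y - y‖) hne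
    have hpos : 0 < ‖π b y - y‖ := norm_pos_iff.2 (Finset.mem_filter.1 hb).2
    -- A slice of the orbit smaller than every nonzero displacement contains some `π g y`. This is
    -- the barycentre of the `π (g * c) y` with `c ∈ B`, so one of those lies in the slice too, at
    -- distance `‖π c y - y‖`: too far.
    obtain ⟨l, a, ⟨_, ⟨g, rfl⟩, hg⟩, hdiam⟩ := hX.exists_slice
      (D := Set.range fun g => π g y) (Set.range_nonempty _) (M := ‖y‖)
      (by rintro _ ⟨g, rfl⟩; exact ((π g).norm_map y).le) (half_pos hpos)
    have hsum : ∑ c ∈ B, l (π g y) ≤ ∑ c ∈ B, l (π (g * c) y) := by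
      have h1 : ∑ c ∈ B, (l (π (g * c) y) - l (π g y)) = 0 := by
        have h2 := congrArg (fun x => l (π g x)) hB
        simpa only [map_sum, map_sub, map_zero, map_mul_apply] using h2
      rw [Finset.sum_sub_distrib, sub_eq_zero] at h1
      exact h1.ge
    obtain ⟨c, hc, hlc⟩ := Finset.exists_le_of_sum_le hne hsum
    have h1 := hdiam _ ⟨g * c, rfl⟩ _ ⟨g, rfl⟩ (hg.trans_le hlc) hg
    simp only [map_mul_apply, ← map_sub, LinearIsometryEquiv.norm_map]
      at h1
    have h2 := hmin c hc
    linarith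

/-- The operator averaging the action over a finite set of group elements. -/
noncomputable def average (π : G →* (X ≃ₗᵢ[ℝ] X)) (E : Finset G) : X →L[ℝ] X :=
  (E.card : ℝ)⁻¹ • ∑ c ∈ E, ((π c).toContinuousLinearEquiv : X →L[ℝ] X)

theorem average_apply (π : G →* (X ≃ₗᵢ[ℝ] X)) (E : Finset G) (x : X) :
    average π E x = (E.card : ℝ)⁻¹ • ∑ c ∈ E, π c x := by
  simp [average]

theorem average_apply_sub (π : G →* (X ≃ₗᵢ[ℝ] X)) {E : Finset G} (hE : E.Nonempty) (x : X) :
    average π E x - x = (E.card : ℝ)⁻¹ • ∑ c ∈ E, (π c x - x) := by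
  have : (E.card : ℝ) ≠ 0 := by exact_mod_cast hE.card_pos.ne'
  rw [average_apply, Finset.sum_sub_distrib, smul_sub, Finset.sum_const,
    ← Nat.cast_smul_eq_nsmul ℝ, inv_smul_smul₀ this]

theorem norm_average_le (π : G →* (X ≃ₗᵢ[ℝ] X)) (E : Finset G) : ‖average π E‖ ≤ 1 := by
  refine ContinuousLinearMap.opNorm_le_bound _ zero_le_one fun x => ?_
  rw [average_apply, norm_smul, norm_inv, RCLike.norm_natCast, one_mul]
  have h : ‖∑ c ∈ E, π c x‖ ≤ E.card * ‖x‖ := by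
    refine (norm_sum_le _ _).trans ?_
    simp
  exact inv_mul_le_of_le_mul₀ (by positivity) (norm_nonneg _) h

/-- A finite set of group elements is stable if it is nonempty and invariant under conjugation by
the elements of the subgroup `F`. -/
def IsStable (F : Subgroup G) (E : Finset G) : Prop :=
  E.Nonempty ∧ ∀ f ∈ F, ∀ c ∈ E, f * c * f⁻¹ ∈ E

theorem IsStable.union [DecidableEq G] {F : Subgroup G} {E E' : Finset G} (h : IsStable F E)
    (h' : IsStable F E') : IsStable F (E ∪ E') := by
  refine ⟨h.1.mono Finset.subset_union_left, fun f hf c hc => ?_⟩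
  rcases Finset.mem_union.1 hc with hc | hc
  · exact Finset.mem_union_left _ (h.2 f hf c hc)
  · exact Finset.mem_union_right _ (h'.2 f hf c hc)

theorem isStable_singleton_one (F : Subgroup G) : IsStable F {1} := by
  refine ⟨Finset.singleton_nonempty 1, fun f _ c hc => ?_⟩
  simp [Finset.mem_singleton.1 hc]

theorem exists_isStable_mem {F : Subgroup G} {g : G} (hg : g ∈ fcSubgroup F) :
    ∃ E, IsStable F E ∧ g ∈ E := by
  have hfin : {h : G | ∃ f ∈ F, h = f * g * f⁻¹}.Finite := hg
  have hmem : g ∈ hfin.toFinset := hfin.mem_toFinset.2 ⟨1, F.one_mem, by simp⟩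
  refine ⟨hfin.toFinset, ⟨⟨g, hmem⟩, fun f hf c hc => ?_⟩, hmem⟩
  obtain ⟨f', hf', rfl⟩ := hfin.mem_toFinset.1 hc
  exact hfin.mem_toFinset.2 ⟨f * f', F.mul_mem hf hf', by simp [mul_assoc]⟩

/-- A bounded closed convex set which is invariant under the averages over all stable finite sets
contains a vector fixed by `FC_G(F)`. -/
theorem exists_mem_invariants [TopologicalSpace.SeparableSpace X] (hX : IsReflexiveSpace X)
    (π : G →* (X ≃ₗᵢ[ℝ] X)) (F : Subgroup G) {K : Set X} (hK : IsClosed K) (hc : Convex ℝ K)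
    (hne : K.Nonempty) {M : ℝ} (hM : ∀ x ∈ K, ‖x‖ ≤ M)
    (hp : ∀ E, IsStable F E → ∀ x ∈ K, average π E x ∈ K) :
    ∃ y ∈ K, y ∈ invariants π (fcSubgroup F) := by
  classical
  let ι := {E : Finset G // IsStable F E}
  have : Nonempty ι := ⟨⟨{1}, isStable_singleton_one F⟩⟩
  have : IsDirectedOrder ι := ⟨fun E E' => ⟨⟨E.1 ∪ E'.1, E.2.union E'.2⟩,
    Finset.subset_union_left, Finset.subset_union_right⟩⟩
  have hfix : ∀ E : ι, ∃ y ∈ K, ∀ c ∈ E.1, π c y = y := fun E => by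
    obtain ⟨y, hy, hpy⟩ := hX.exists_fixed_mem hK hc hne hM (average π E.1) (hp E.1 E.2)
    refine ⟨y, hy, apply_eq_of_sum_apply_sub_eq_zero hX π ?_⟩
    rw [← sub_eq_zero, average_apply_sub π E.2.1, smul_eq_zero] at hpy
    refine hpy.resolve_left (inv_ne_zero ?_)
    exact_mod_cast E.2.1.card_pos.ne'
  choose y hyK hy using hfix
  -- Refining `atTop` makes each `g ∈ FC_G(F)` fix `y E` for `U`-almost all `E`, and this passes to
  -- the weak limit.
  let U : Ultrafilter ι := Ultrafilter.of atTop
  obtain ⟨z, hz⟩ := hX.exists_weak_limit U fun E => hM _ (hyK E)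
  refine ⟨z, hK.mem_of_weak_limit hc (Eventually.of_forall hyK) hz, fun g hg => ?_⟩
  obtain ⟨E, hE, hgE⟩ := exists_isStable_mem hg
  have hev : ∀ᶠ E' in (U : Filter ι), π g (y E') = y E' :=
    Ultrafilter.of_le atTop ((eventually_ge_atTop (⟨E, hE⟩ : ι)).mono
      fun E' hE' => hy E' g (hE' hgE))
  refine eq_of_sub_eq_zero (SeparatingDual.eq_zero_of_forall_dual_eq_zero (R := ℝ) fun l => ?_)
  rw [map_sub, sub_eq_zero]
  have h1 := hz (l.comp ((π g).toContinuousLinearEquiv : X →L[ℝ] X))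
  exact tendsto_nhds_unique h1 ((hz l).congr' (hev.mono fun E' h => (congrArg l h).symm))

/-- A convex semigroup of contractions that contains the averages over all stable finite sets
makes any finite set of vectors small. -/
theorem exists_forall_norm_apply_lt [TopologicalSpace.SeparableSpace X] (hX : IsReflexiveSpace X)
    (π : G →* (X ≃ₗᵢ[ℝ] X)) (F : Subgroup G) (hF : invariants π (fcSubgroup F) = ⊥)
    {P : Set (X →L[ℝ] X)} (hconv : Convex ℝ P) (hmul : ∀ p ∈ P, ∀ q ∈ P, p.comp q ∈ P)
    (hnorm : ∀ p ∈ P, ‖p‖ ≤ 1) (hP : ∀ E, IsStable F E → average π E ∈ P)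
    (t : Finset X) {ε : ℝ} (hε : 0 < ε) : ∃ p ∈ P, ∀ x ∈ t, ‖p x‖ < ε := by
  classical
  have hle : ∀ p ∈ P, ∀ x, ‖p x‖ ≤ ‖x‖ := fun p hp x => by
    simpa using p.le_of_opNorm_le (hnorm p hp) x
  have hone : ∀ x, ∃ p ∈ P, ‖p x‖ < ε := by
    intro x
    let ev : (X →L[ℝ] X) →ₗ[ℝ] X := (ContinuousLinearMap.apply ℝ X x).toLinearMap
    -- The invariant vector in the closure of `P x` must be `0`.
    obtain ⟨y, hy, hyF⟩ := exists_mem_invariants hX π F (K := closure (ev '' P)) isClosed_closure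
      (hconv.linear_image ev).closure
      (Set.Nonempty.closure ⟨_, _, hP _ (isStable_singleton_one F), rfl⟩) (M := ‖x‖)
      (fun z hz => by
        refine closure_minimal (t := {z | ‖z‖ ≤ ‖x‖}) ?_
          (isClosed_le continuous_norm continuous_const) hz
        rintro _ ⟨p, hp, rfl⟩
        exact hle p hp x)
      (fun E hE z hz => by
        refine map_mem_closure (average π E).continuous hz ?_
        rintro _ ⟨p, hp, rfl⟩
        exact ⟨_, hmul _ (hP E hE) p hp, rfl⟩)
    rw [hF, Submodule.mem_bot] at hyF
    rw [hyF, Metric.mem_closure_iff] at hy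
    obtain ⟨_, ⟨p, hp, rfl⟩, hpx⟩ := hy ε hε
    rw [dist_zero_left] at hpx
    exact ⟨p, hp, hpx⟩
  induction t using Finset.induction_on with
  | empty => exact ⟨_, hP _ (isStable_singleton_one F), by simp⟩
  | insert a s _ ih =>
    obtain ⟨p, hp, hps⟩ := ih
    -- Shrinking `p a` by a contraction `q` keeps the vectors already treated small.
    obtain ⟨q, hq, hqa⟩ := hone (p a)
    refine ⟨q.comp p, hmul q hq p hp, fun x hx => ?_⟩
    rcases Finset.mem_insert.1 hx with rfl | hx
    · exact hqa
    · exact (hle q hq _).trans_lt (hps x hx)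

end AlmostInvariant

/-! ### Vanishing of the restriction map -/

section Cohomology

variable {G X : Type*} [Group G] [NormedAddCommGroup X] [NormedSpace ℝ X]

/-- Post-composition of cochains with an operator. -/
def postcomp (p : X →L[ℝ] X) (n : ℕ) : Cochain G X n →ₗ[ℝ] Cochain G X n where
  toFun φ g := p (φ g)
  map_add' φ ψ := by
    funext g
    simp
  map_smul' c φ := by
    funext g
    simp

theorem coboundary_postcomp (π : G →* (X ≃ₗᵢ[ℝ] X)) {p : X →L[ℝ] X}
    (hp : ∀ g x, p (π g x) = π g (p x)) (n : ℕ) (φ : Cochain G X n) :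
    coboundary π n (postcomp p n φ) = postcomp p (n + 1) (coboundary π n φ) := by
  funext g
  simp [coboundary, postcomp, hp]

/-- The contractions commuting with `F` whose action on the cohomology of `F` fixes all classes
restricted from `G`. -/
def trivialContractions (π : G →* (X ≃ₗᵢ[ℝ] X)) (F : Subgroup G) (n : ℕ) : Set (X →L[ℝ] X) :=
  {p | ‖p‖ ≤ 1 ∧ (∀ (f : F) x, p (restrict π F f x) = restrict π F f (p x)) ∧
    ∀ φ ∈ cocycles π (n + 1), postcomp p (n + 1) (resCochain X F (n + 1) φ)
      - resCochain X F (n + 1) φ ∈ coboundaries (restrict π F) (n + 1)}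

theorem convex_trivialContractions (π : G →* (X ≃ₗᵢ[ℝ] X)) (F : Subgroup G) (n : ℕ) :
    Convex ℝ (trivialContractions π F n) := by
  intro p hp q hq a b ha hb hab
  refine ⟨?_, fun f x => ?_, fun φ hφ => ?_⟩
  · have := convex_closedBall (0 : X →L[ℝ] X) 1 (mem_closedBall_zero_iff.2 hp.1)
      (mem_closedBall_zero_iff.2 hq.1) ha hb hab
    exact mem_closedBall_zero_iff.1 this
  · simp only [add_apply, smul_apply, hp.2.1, hq.2.1, map_add, map_smul]
  · have h := Submodule.add_mem _ (Submodule.smul_mem _ a (hp.2.2 φ hφ))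
      (Submodule.smul_mem _ b (hq.2.2 φ hφ))
    convert h using 1
    funext k
    simp only [postcomp, LinearMap.coe_mk, AddHom.coe_mk, Pi.sub_apply, Pi.add_apply,
      Pi.smul_apply, add_apply, smul_apply]
    have : resCochain X F (n + 1) φ k
        = a • resCochain X F (n + 1) φ k + b • resCochain X F (n + 1) φ k := by
      rw [← add_smul, hab, one_smul]
    rw [smul_sub, smul_sub]
    nth_rw 3 [this]
    abel

/-- On `φ|_F`, `p q - 1 = p (q - 1) + (p - 1)`, and `p` preserves coboundaries because it commutes
with `F`. -/
theorem comp_mem_trivialContractions {π : G →* (X ≃ₗᵢ[ℝ] X)} {F : Subgroup G} {n : ℕ}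
    {p q : X →L[ℝ] X} (hp : p ∈ trivialContractions π F n) (hq : q ∈ trivialContractions π F n) :
    p.comp q ∈ trivialContractions π F n := by
  refine ⟨?_, fun f x => ?_, fun φ hφ => ?_⟩
  · exact (p.opNorm_comp_le q).trans (mul_le_one₀ hp.1 (norm_nonneg _) hq.1)
  · simp only [ContinuousLinearMap.comp_apply, hp.2.1, hq.2.1]
  · obtain ⟨ψ, hψ⟩ := hq.2.2 φ hφ
    have h : postcomp p (n + 1) (postcomp q (n + 1) (resCochain X F (n + 1) φ)
        - resCochain X F (n + 1) φ) ∈ coboundaries (restrict π F) (n + 1) :=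
      ⟨postcomp p n ψ, by rw [coboundary_postcomp _ hp.2.1, hψ]⟩
    have h2 := Submodule.add_mem _ h (hp.2.2 φ hφ)
    rwa [map_sub, sub_add_sub_cancel] at h2

theorem average_mem_trivialContractions (π : G →* (X ≃ₗᵢ[ℝ] X)) {F : Subgroup G} {E : Finset G}
    (hE : IsStable F E) (n : ℕ) : average π E ∈ trivialContractions π F n := by
  refine ⟨norm_average_le π E, fun f x => ?_, fun φ hφ => ?_⟩
  · rw [average_apply, average_apply, map_smul, map_sum]
    congr 1
    refine Finset.sum_nbij' (fun c => (f : G)⁻¹ * c * f) (fun c => (f : G) * c * (f : G)⁻¹)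
      (fun c hc => ?_) (fun c hc => hE.2 _ f.2 c hc) ?_ ?_ ?_
    · simpa using hE.2 _ (F.inv_mem f.2) c hc
    · intro c _
      simp [mul_assoc]
    · intro c _
      simp [mul_assoc]
    · intro c _
      change π c (π f x) = π f (π ((f : G)⁻¹ * c * f) x)
      rw [← map_mul_apply, ← map_mul_apply]
      simp [mul_assoc]
  · have h := Submodule.smul_mem _ (E.card : ℝ)⁻¹ (sum_sub_mem_coboundaries π F hφ hE.2)
    convert h using 1
    funext k
    exact average_apply_sub π hE.1 _

theorem resCochain_mem_topologicalClosure [TopologicalSpace.SeparableSpace X]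
    (hX : IsReflexiveSpace X) (π : G →* (X ≃ₗᵢ[ℝ] X)) (F : Subgroup G)
    (hF : invariants π (fcSubgroup F) = ⊥) {n : ℕ} {φ : Cochain G X n} (hφ : φ ∈ cocycles π n) :
    resCochain X F n φ ∈ (coboundaries (restrict π F) n).topologicalClosure := by
  classical
  cases n with
  | zero =>
    -- A degree-zero cocycle is a `G`-invariant vector, in particular `FC_G(F)`-invariant.
    have h0 : ∀ k, φ k = 0 := by
      intro k
      have h1 : φ k ∈ invariants π (fcSubgroup F) := fun g _ => by
        have h2 : coboundary π 0 φ = 0 := hφ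
        have h3 := congrFun h2 (fun _ => g)
        simp only [coboundary_apply, innerCoboundary_zero, Pi.zero_apply, sub_neg_eq_add,
          Subsingleton.elim (Fin.tail fun _ : Fin 1 => g) k] at h3
        exact (neg_add_eq_zero.1 h3)
      rwa [hF, Submodule.mem_bot] at h1
    rw [show φ = 0 from funext h0, map_zero]
    exact Submodule.zero_mem _
  | succ n =>
    change _ ∈ closure _
    rw [mem_closure_iff_nhds]
    intro V hV
    rw [nhds_pi, Filter.mem_pi] at hV
    obtain ⟨I, hI, s, hs, hsV⟩ := hV
    have hball : ∀ k, ∃ r > 0, Metric.ball (resCochain X F (n + 1) φ k) r ⊆ s k :=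
      fun k => Metric.mem_nhds_iff.1 (hs k)
    choose r hr hrs using hball
    obtain ⟨ε, hε, hεr⟩ : ∃ ε > 0, ∀ k ∈ hI.toFinset, ε ≤ r k := by
      rcases hI.toFinset.eq_empty_or_nonempty with h | h
      · exact ⟨1, one_pos, by simp [h]⟩
      · obtain ⟨k, _, hk⟩ := hI.toFinset.exists_min_image r h
        exact ⟨r k, hr k, hk⟩
    obtain ⟨p, hp, hpt⟩ := exists_forall_norm_apply_lt hX π F hF
      (convex_trivialContractions π F n) (fun p hp q hq => comp_mem_trivialContractions hp hq)
      (fun p hp => hp.1) (fun E hE => average_mem_trivialContractions π hE n)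
      (hI.toFinset.image (resCochain X F (n + 1) φ)) hε
    refine ⟨_, hsV fun k hk => hrs k ?_, Submodule.neg_mem _ (hp.2.2 φ hφ)⟩
    have hk' := hI.mem_toFinset.2 hk
    have h := hpt _ (Finset.mem_image_of_mem _ hk')
    rw [mem_ball_iff_norm]
    have h2 : (-(postcomp p (n + 1) (resCochain X F (n + 1) φ) - resCochain X F (n + 1) φ)) k
        - resCochain X F (n + 1) φ k = -p (resCochain X F (n + 1) φ k) := by
      simp [postcomp]
    rw [h2, norm_neg]
    exact h.trans_le (hεr k hk')

end Cohomology

end IsometricModule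

theorem mainTheorem6 {G X : Type*} [Group G] [NormedAddCommGroup X] [NormedSpace ℝ X]
    [CompleteSpace X] [TopologicalSpace.SeparableSpace X] (hX : IsReflexiveSpace X)
    (π : G →* (X ≃ₗᵢ[ℝ] X)) (F : Subgroup G)
    (hF : IsometricModule.invariants π (fcSubgroup F) = ⊥) :
    (∀ n : ℕ, IsometricModule.resReducedCohomology π F n = 0) ∧
    (∀ α : G →* (X ≃ᵃⁱ[ℝ] X), IsometricModule.HasLinearPart α π →
      IsometricModule.HasAlmostFixedPoints (α.comp F.subtype)) := by
  open IsometricModule in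
  refine ⟨fun n => ?_, fun α hα E ε hε => ?_⟩
  · refine Submodule.linearMap_qext _ (LinearMap.ext fun φ => ?_)
    exact (Submodule.Quotient.mk_eq_zero _).2
      (resCochain_mem_topologicalClosure hX π F hF φ.2)
  · have hα' : ∀ g x, α g x = π g x + α g 0 := fun g x => by
      have h := (α g).map_vadd 0 x
      rw [hα g] at h
      simpa using h
    -- The translation part is a `1`-cocycle. If `x` is the value of a `0`-cochain whose coboundary
    -- approximates it, then `x - α g x = (x - π g x) - b g` is small on `E`.
    let b : Cochain G X 1 := fun g => α (g 0) 0
    have hb : b ∈ cocycles π 1 := by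
      change coboundary π 1 b = 0
      funext g
      obtain ⟨x, g, rfl⟩ : ∃ k l', g = Fin.cons k l' := ⟨_, _, (Fin.cons_self_tail g).symm⟩
      obtain ⟨y, g, rfl⟩ : ∃ k l', g = Fin.cons k l' := ⟨_, _, (Fin.cons_self_tail g).symm⟩
      have h : α (x * y) 0 = π x (α y 0) + α x 0 := by
        rw [map_mul, ← hα' x]
        rfl
      rw [coboundary_apply, innerCoboundary_succ, innerCoboundary_zero]
      simp [b, -map_mul, h]
    have hcl := resCochain_mem_topologicalClosure hX π F hF hb
    change _ ∈ closure _ at hcl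
    let c : F → (Fin 1 → F) := fun g _ => g
    have hU : (c '' E).pi (fun k => Metric.ball (resCochain X F 1 b k) ε)
        ∈ 𝓝 (resCochain X F 1 b) :=
      set_pi_mem_nhds (E.finite_toSet.image c) fun k _ => Metric.ball_mem_nhds _ hε
    obtain ⟨_, hψ, ψ, rfl⟩ := mem_closure_iff_nhds.1 hcl _ hU
    refine ⟨ψ Fin.elim0, fun g hg => ?_⟩
    have h := hψ (c g) ⟨g, hg, rfl⟩
    rw [mem_ball_iff_norm, coboundary_apply, innerCoboundary_zero,
      Subsingleton.elim (Fin.tail (c g)) Fin.elim0] at h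
    have h2 : ψ Fin.elim0 - (α.comp F.subtype) g (ψ Fin.elim0)
        = -restrict π F (c g 0) (ψ Fin.elim0) - -ψ Fin.elim0 - resCochain X F 1 b (c g) := by
      change ψ Fin.elim0 - α g (ψ Fin.elim0) = -π g (ψ Fin.elim0) - -ψ Fin.elim0 - α g 0
      rw [hα']
      abel
    rw [h2]
    exact h
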